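/- Let $\pi : Y\to X$ be a smooth fibre bundle between connected (Hausdorff, second countable, finite-dimensional) smooth manifolds, $n=\dim X$, with fibred coordinates $(x^\lambda,y^i)$ on $Y$. Let $J^1Y$ be its first order jet manifold, with coordinates $(x^\lambda,y^i,y^i_\lambda)$, and let $\Pi=\bigwedge^nT^*X\otimes_Y V^*Y\otimes_Y TX$, $\pi_{\Pi Y}:\Pi\to Y$, be the Legendre bundle, with coordinates $(x^\lambda,y^i,p^\lambda_i)$. Write $\omega=dx^1\wedge\cdots\wedge dx^n$, $\omega_\lambda=\partial_\lambda\rfloor\omega$, $\partial^\lambda_i=\partial/\partial y^i_\lambda$, $\partial^i_\lambda=\partial/\partial p^\lambda_i$. Let $L=\mathcal L\omega: J^1Y\to\bigwedge^nT^*X$ be a smooth Lagrangian, $\pi^\lambda_i=\partial^\lambda_i\mathcal L$, $\widehat L:J^1Y\to\Pi$, $p^\lambda_i\circ\widehat L=\pi^\lambda_i$, its Legendre map, and $N_L=\widehat L(J^1Y)$. Suppose that $L$ is almost regular: $N_L$ is a closed imbedded subbundle of $\Pi\to Y$, and $\widehat L:J^1Y\to N_L$ is a surjective submersion with connected fibres.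 Let $H=p^\lambda_i\,dy^i\wedge\omega_\lambda-\mathcal H\omega$ be a smooth Hamiltonian form on $\Pi$ (the pull-back of the form $p\,\omega+p^\lambda_i\,dy^i\wedge\omega_\lambda$ by a global section of $T^*Y\wedge\bigwedge^{n-1}T^*X\to\Pi$), and let $\widehat H:\Pi\to J^1Y$, $y^i_\lambda\circ\widehat H=\partial^i_\lambda\mathcal H$, be its Hamiltonian map. Suppose that $H$ is weakly associated with $L$: $\widehat L\circ\widehat H\circ\widehat L=\widehat L$, and the equality $H=p^\lambda_i\,dy^i\wedge\omega_\lambda-p^\lambda_i(y^i_\lambda\circ\widehat H)\,\omega+\widehat H^*L$ holds at all points of $N_L$. Let $r$ be a smooth section of $\Pi\to X$ which solves the Hamilton equations $$\partial_\lambda y^i=\partial^i_\lambda\mathcal H,\qquad \partial_\lambda p^\lambda_i=-\partial_i\mathcal H,$$ and takes its values in $N_L$. Then the smooth section $s=\pi_{\Pi Y}\circ r$ of $Y\to X$ satisfies the Euler–Lagrange equations $(\partial_i-d_\lambda\partial^\lambda_i)\mathcal L=0$, where $d_\lambda=\partial_\lambda+y^j_\lambda\partial_j+y^j_{\lambda\mu}\partial^\mu_j$,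 and the smooth section $\bar s=\widehat H\circ r$ of $J^1Y\to X$ satisfies the Cartan equations $$\partial^\lambda_i\pi^\mu_j\,(\widehat y^j_\mu-y^j_\mu)=0,\qquad \partial_i\mathcal L-\widehat d_\lambda\pi^\lambda_i+(\widehat y^j_\lambda-y^j_\lambda)\,\partial_i\pi^\lambda_j=0,$$ where $\widehat d_\lambda=\partial_\lambda+\widehat y^j_\lambda\partial_j+y^j_{\lambda\mu}\partial^\mu_j$, evaluated on $\bar s$ with $\widehat y^i_\lambda=\partial_\lambda y^i$ and $y^i_{\lambda\mu}=\partial_\lambda y^i_\mu$. -/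

import Mathlib

open scoped Manifold ContDiff

noncomputable section

namespace Polysymplectic

/-- Coordinate space `ℝⁿ`. -/
abbrev Euc (n : ℕ) : Type := EuclideanSpace ℝ (Fin n)

/-- The space of arrays `(v^i_l)`, `1 ≤ l ≤ n`, `1 ≤ i ≤ m`; it carries the jet coordinates
`y^i_l = v l i` as well as the momentum coordinates `p^l_i = p l i`. -/
abbrev Arr (n m : ℕ) : Type := Fin n → Euc m

/-- The `l`-th coordinate vector of `ℝⁿ`. -/
abbrev bvec {n : ℕ} (l : Fin n) : Euc n := EuclideanSpace.single l 1

/-- The array whose only nonzero entry is a `1` at place `(l, i)`. -/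
def bArr {n m : ℕ} (l : Fin n) (i : Fin m) : Arr n m := Pi.single l (bvec i)

/-- The form `dx¹ ∧ ⋯ ∧ dxⁿ` on `ℝⁿ`. -/
def stdVol (n : ℕ) : Euc n [⋀^Fin n]→L[ℝ] ℝ :=
  { (EuclideanSpace.basisFun (Fin n) ℝ).toBasis.det with
    cont := by
      change Continuous fun v : Fin n → Euc n =>
        (EuclideanSpace.basisFun (Fin n) ℝ).toBasis.det v
      simp only [Module.Basis.det_apply]
      refine Continuous.matrix_det ?_
      refine continuous_matrix fun i j => ?_
      simp only [Module.Basis.toMatrix_apply, OrthonormalBasis.coe_toBasis_repr_apply,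
        EuclideanSpace.basisFun_repr]
      fun_prop }

variable (n m : ℕ) {X Y : Type*}
  [TopologicalSpace X] [ChartedSpace (Euc n) X]
  [TopologicalSpace Y] [ChartedSpace (Euc n × Euc m) Y]

/-! ### Smooth fibre bundles and fibred charts -/

/-- `π : Y → X` is a smooth fibre bundle with typical fibre the manifold `M`: it is smooth and
locally trivial, by local trivializations that are diffeomorphisms. -/
structure IsSmoothFibreBundle (M : Type*) [TopologicalSpace M] [ChartedSpace (Euc m) M]
    (π : Y → X) : Prop where
  smooth : ContMDiff 𝓘(ℝ, Euc n × Euc m) 𝓘(ℝ, Euc n) ∞ π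
  locallyTrivial : ∀ x : X, ∃ e : Bundle.Trivialization M π, x ∈ e.baseSet ∧
    ContMDiffOn 𝓘(ℝ, Euc n × Euc m) (𝓘(ℝ, Euc n).prod 𝓘(ℝ, Euc m)) ∞ e e.source ∧
    ContMDiffOn (𝓘(ℝ, Euc n).prod 𝓘(ℝ, Euc m)) 𝓘(ℝ, Euc n × Euc m) ∞
      e.toOpenPartialHomeomorph.symm e.target

/-- Fibred coordinates `(x^l, y^i)` on `Y`, over coordinates `(x^l)` on `X`. -/
structure FibredChart (π : Y → X) where
  /-- the chart `(x^l, y^i)` of `Y` -/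
  total : OpenPartialHomeomorph Y (Euc n × Euc m)
  /-- the chart `(x^l)` of `X` -/
  base : OpenPartialHomeomorph X (Euc n)
  total_mem : total ∈ IsManifold.maximalAtlas 𝓘(ℝ, Euc n × Euc m) ∞ Y
  base_mem : base ∈ IsManifold.maximalAtlas 𝓘(ℝ, Euc n) ∞ X
  mapsTo : ∀ y ∈ total.source, π y ∈ base.source
  fst_eq : ∀ y ∈ total.source, (total y).1 = base (π y)

variable {n m}

theorem IsSmoothFibreBundle.exists_fibredChart [IsManifold 𝓘(ℝ, Euc n) ∞ X]
    [IsManifold 𝓘(ℝ, Euc n × Euc m) ∞ Y]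
    {M : Type*} [TopologicalSpace M] [ChartedSpace (Euc m) M] [IsManifold 𝓘(ℝ, Euc m) ∞ M]
    {π : Y → X} (hπ : IsSmoothFibreBundle n m M π) (y : Y) :
    ∃ c : FibredChart n m π, y ∈ c.total.source := by
  obtain ⟨e, hx, he, he'⟩ := hπ.locallyTrivial (π y)
  have hy : y ∈ e.source := e.mem_source.2 hx
  let f := (chartAt (Euc n) (π y)).prod (chartAt (Euc m) (e y).2)
  have hf : ContMDiffOn (𝓘(ℝ, Euc n).prod 𝓘(ℝ, Euc m)) 𝓘(ℝ, Euc n × Euc m) ∞ f f.source := by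
    rw [modelWithCornersSelf_prod, ← chartedSpaceSelf_prod]
    exact contMDiffOn_chart.prodMap contMDiffOn_chart
  have hf' : ContMDiffOn 𝓘(ℝ, Euc n × Euc m) (𝓘(ℝ, Euc n).prod 𝓘(ℝ, Euc m)) ∞
      f.symm f.target := by
    rw [modelWithCornersSelf_prod, ← chartedSpaceSelf_prod]
    exact contMDiffOn_chart_symm.prodMap contMDiffOn_chart_symm
  refine ⟨⟨e.toOpenPartialHomeomorph.trans f, chartAt (Euc n) (π y), ?_,
    IsManifold.chart_mem_maximalAtlas _, ?_, ?_⟩, ?_⟩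
  · refine OpenPartialHomeomorph.mem_maximalAtlas_of_contMDiffOn _ ?_ ?_
    · exact hf.comp (he.mono fun z hz => hz.1) fun z hz => hz.2
    · exact he'.comp (hf'.mono fun z hz => hz.1) fun z hz => hz.2
  · intro z hz
    have h2 : e z ∈ f.source := hz.2
    rw [← e.proj_toFun z hz.1]
    exact h2.1
  · intro z hz
    change (chartAt (Euc n) (π y)) (e z).1 = _
    rw [e.coe_fst hz.1]
  · refine ⟨hy, ?_⟩
    change e y ∈ f.source
    refine ⟨?_, mem_chart_source _ _⟩
    rw [e.coe_fst hy]
    exact mem_chart_source _ _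

/-! ### Tangent vectors, the jet bundle and the Legendre bundle

The tangent spaces `T_x X` and `T_y Y` are Mathlib's, which are type synonyms of the model spaces
`Euc n` and `Euc n × Euc m`. -/

section Bundles

variable (n m)

/-- The tangent map `T_y π : T_y Y → T_{π y} X`. -/
def dproj (π : Y → X) (y : Y) : Euc n × Euc m →L[ℝ] Euc n :=
  mfderiv 𝓘(ℝ, Euc n × Euc m) 𝓘(ℝ, Euc n) π y

/-- The vertical tangent space `V_y Y = ker T_y π`. -/
abbrev Vert (π : Y → X) (y : Y) : Submodule ℝ (Euc n × Euc m) := (dproj n m π y).ker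

/-- The fibre over `y` of `J¹Y → Y`: the tangent maps `T_x X → T_y Y`, `x = π y`, of local sections
of `Y → X` through `y`, that is the linear right inverses of `T_y π`. -/
abbrev JetAt (π : Y → X) (y : Y) : Type :=
  {Γ : Euc n →L[ℝ] Euc n × Euc m // (dproj n m π y).comp Γ = ContinuousLinearMap.id ℝ (Euc n)}

/-- The fibre `⋀ⁿ T*_x X ⊗ V*_y Y ⊗ T_x X` over `y` of the Legendre bundle `Π`, written as the space
of linear maps `T*_x X ⊗ V_y Y = Hom (T_x X, V_y Y) → ⋀ⁿ T*_x X`. -/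
abbrev LegAt (π : Y → X) (y : Y) : Type :=
  (Euc n →L[ℝ] Vert n m π y) →L[ℝ] (Euc n [⋀^Fin n]→L[ℝ] ℝ)

/-- The total space of the jet bundle `J¹Y`. -/
structure JetBundle (π : Y → X) where
  pt : Y
  jet : JetAt n m π pt

/-- The total space of the Legendre bundle `Π`. -/
structure LegendreBundle (π : Y → X) where
  pt : Y
  mom : LegAt n m π pt

end Bundles

variable {π : Y → X}

/-- `J¹_y Y` is an affine space over `Hom (T_x X, V_y Y)`. -/
def JetAt.add {y : Y} (Γ : JetAt n m π y) (σ : Euc n →L[ℝ] Vert n m π y) : JetAt n m π y :=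
  ⟨Γ.1 + (Vert n m π y).subtypeL.comp σ, by
    have h := Γ.2
    ext1 v
    have h1 : dproj n m π y (Γ.1 v) = v := congrArg (fun f => f v) h
    have h2 : dproj n m π y (σ v : Euc n × Euc m) = 0 := (σ v).2
    simp [h1, h2]⟩

/-- The vertical part `w - Γ (T_y π w)` of a tangent vector `w` at `y` (the value on `w` of the
contact form at the jet `Γ`). -/
def JetAt.vertPart {y : Y} (Γ : JetAt n m π y) (w : Euc n × Euc m) : Vert n m π y :=
  ⟨w - Γ.1 (dproj n m π y w), by
    have h1 : dproj n m π y (Γ.1 (dproj n m π y w)) = dproj n m π y w :=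
      congrArg (fun f => f (dproj n m π y w)) Γ.2
    rw [LinearMap.mem_ker]
    change dproj n m π y _ = 0
    rw [map_sub, h1, sub_self]⟩

/-- For `q = p^l_i` in `Π_y` and a vertical vector `u`, the number
`∑_l p^l_i u^i ω (v₁, …, ∂_l, …, vₙ)` with `∂_l` in place `k`. This is the value of the `n`-form
`p^l_i dy^i ∧ ω_l` on vectors `w₁, …, wₙ` with `w_k = u` and `T_y π w_j = v_j` for `j ≠ k`. -/
def LegAt.contr {y : Y} (q : LegAt n m π y) (u : Vert n m π y) (k : Fin n) (v : Fin n → Euc n) :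
    ℝ :=
  ∑ l : Fin n, q ((EuclideanSpace.proj l : Euc n →L[ℝ] ℝ).smulRight u)
    (Function.update v k (bvec l))

/-- The `n`-form `p^l_i dy^i ∧ ω_l - p^l_i Γ^i_l ω = p^l_i (dy^i - Γ^i_h dx^h) ∧ ω_l` on `T_y Y`
given by `q = p^l_i` in `Π_y` and a jet `Γ` at `y`. -/
def LegAt.form {y : Y} (q : LegAt n m π y) (Γ : JetAt n m π y) (w : Fin n → Euc n × Euc m) : ℝ :=
  ∑ k : Fin n, q.contr (Γ.vertPart (w k)) k (fun j => dproj n m π y (w j))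

/-- The `n`-form `z` on `T_y Y` belongs to the fibre of the homogeneous Legendre bundle
`Z_Y = T*Y ∧ ⋀ⁿ⁻¹ T*X` and is projected to `q = p^l_i` in `Π_y`, i.e. `z = p ω + p^l_i dy^i ∧ ω_l`
for some number `p`: first, `z` vanishes as soon as two of its arguments are vertical, and second,
its contractions with vertical vectors are those of `p^l_i dy^i ∧ ω_l`. -/
structure LiesOver {y : Y} (z : (Euc n × Euc m) [⋀^Fin n]→L[ℝ] ℝ) (q : LegAt n m π y) :
    Prop where
  mem_Z : ∀ (w : Fin n → Euc n × Euc m) (j k : Fin n), j ≠ k →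
    w j ∈ Vert n m π y → w k ∈ Vert n m π y → z w = 0
  proj_eq : ∀ (w : Fin n → Euc n × Euc m) (k : Fin n) (u : Vert n m π y),
    z (Function.update w k u) = q.contr u k (fun j => dproj n m π y (w j))

namespace FibredChart

variable (c : FibredChart n m π)

/-! ### Coordinates in a fibred chart -/

/-- The differential `T_y Y → ℝⁿ × ℝᵐ` of the chart `(x^l, y^i)`. -/
def dtotal (y : Y) : Euc n × Euc m →L[ℝ] Euc n × Euc m :=
  mfderiv 𝓘(ℝ, Euc n × Euc m) 𝓘(ℝ, Euc n × Euc m) c.total y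

/-- The differential `ℝⁿ × ℝᵐ → T_y Y` of the inverse of the chart `(x^l, y^i)`. -/
def dtotalInv (y : Y) : Euc n × Euc m →L[ℝ] Euc n × Euc m :=
  mfderiv 𝓘(ℝ, Euc n × Euc m) 𝓘(ℝ, Euc n × Euc m) c.total.symm (c.total y)

/-- The differential `T_x X → ℝⁿ` of the chart `(x^l)`. -/
def dbase (x : X) : Euc n →L[ℝ] Euc n :=
  mfderiv 𝓘(ℝ, Euc n) 𝓘(ℝ, Euc n) c.base x

/-- The differential `ℝⁿ → T_x X` of the inverse of the chart `(x^l)`. -/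
def dbaseInv (x : X) : Euc n →L[ℝ] Euc n :=
  mfderiv 𝓘(ℝ, Euc n) 𝓘(ℝ, Euc n) c.base.symm (c.base x)

/-- The coordinate vectors `∂_l` in `T_x X`. -/
def baseFrame (x : X) (l : Fin n) : Euc n := c.dbaseInv x (bvec l)

variable {c}

theorem total_mdifferentiable : c.total.MDifferentiable
    𝓘(ℝ, Euc n × Euc m) 𝓘(ℝ, Euc n × Euc m) :=
  ⟨(contMDiffOn_of_mem_maximalAtlas c.total_mem).mdifferentiableOn (by simp),
    (contMDiffOn_symm_of_mem_maximalAtlas c.total_mem).mdifferentiableOn (by simp)⟩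

theorem base_mdifferentiable : c.base.MDifferentiable 𝓘(ℝ, Euc n) 𝓘(ℝ, Euc n) :=
  ⟨(contMDiffOn_of_mem_maximalAtlas c.base_mem).mdifferentiableOn (by simp),
    (contMDiffOn_symm_of_mem_maximalAtlas c.base_mem).mdifferentiableOn (by simp)⟩

theorem dbaseInv_dbase {x : X} (hx : x ∈ c.base.source) (v : Euc n) :
    c.dbaseInv x (c.dbase x v) = v :=
  congrArg (fun f => f v) (base_mdifferentiable.symm_comp_deriv hx)

theorem dproj_dtotalInv {y : Y} (hy : y ∈ c.total.source) (w : Euc n × Euc m) :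
    dproj n m π y (c.dtotalInv y w) = c.dbaseInv (π y) w.1 := by
  have hz : c.total y ∈ c.total.target := c.total.map_source hy
  have hb : π y ∈ c.base.source := c.mapsTo y hy
  have hπ : MDifferentiableAt 𝓘(ℝ, Euc n × Euc m) 𝓘(ℝ, Euc n) π y := by
    have h1 : MDifferentiableAt 𝓘(ℝ, Euc n × Euc m) 𝓘(ℝ, Euc n) (fun z => (c.total z).1) y := by
      have h2 : MDifferentiableAt 𝓘(ℝ, Euc n × Euc m) 𝓘(ℝ, Euc n)
          (Prod.fst : Euc n × Euc m → Euc n) (c.total y) :=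
        differentiableAt_fst.mdifferentiableAt
      exact h2.comp y (total_mdifferentiable.mdifferentiableAt hy)
    have h3 : MDifferentiableAt 𝓘(ℝ, Euc n) 𝓘(ℝ, Euc n) c.base.symm ((c.total y).1) := by
      rw [c.fst_eq y hy]
      exact base_mdifferentiable.mdifferentiableAt_symm (c.base.map_source hb)
    refine (h3.comp y h1).congr_of_eventuallyEq ?_
    filter_upwards [c.total.open_source.mem_nhds hy] with z hz
    change π z = c.base.symm (c.total z).1
    rw [c.fst_eq z hz, c.base.left_inv (c.mapsTo z hz)]
  have key : mfderiv 𝓘(ℝ, Euc n × Euc m) 𝓘(ℝ, Euc n) (π ∘ c.total.symm) (c.total y) =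
      mfderiv 𝓘(ℝ, Euc n × Euc m) 𝓘(ℝ, Euc n)
        (c.base.symm ∘ (Prod.fst : Euc n × Euc m → Euc n)) (c.total y) := by
    apply Filter.EventuallyEq.mfderiv_eq
    filter_upwards [c.total.open_target.mem_nhds hz] with z hz
    have h := c.fst_eq _ (c.total.map_target hz)
    rw [c.total.right_inv hz] at h
    simp only [Function.comp_apply]
    rw [h, c.base.left_inv (c.mapsTo _ (c.total.map_target hz))]
  rw [mfderiv_comp_of_eq (by rw [c.total.left_inv hy]; exact hπ)
    (total_mdifferentiable.mdifferentiableAt_symm hz) rfl] at key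
  have hfst : MDifferentiableAt 𝓘(ℝ, Euc n × Euc m) 𝓘(ℝ, Euc n)
      (Prod.fst : Euc n × Euc m → Euc n) (c.total y) := differentiableAt_fst.mdifferentiableAt
  have hb' : MDifferentiableAt 𝓘(ℝ, Euc n) 𝓘(ℝ, Euc n) c.base.symm (c.total y).1 := by
    rw [c.fst_eq y hy]
    exact base_mdifferentiable.mdifferentiableAt_symm (c.base.map_source hb)
  rw [mfderiv_comp_of_eq hb' hfst rfl] at key
  have key2 := congrArg (fun f => f w) key
  have h5 : mfderiv 𝓘(ℝ, Euc n × Euc m) 𝓘(ℝ, Euc n)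
      (Prod.fst : Euc n × Euc m → Euc n) (c.total y) =
        ContinuousLinearMap.fst ℝ (Euc n) (Euc m) := by
    rw [mfderiv_eq_fderiv]
    exact fderiv_fst
  rw [h5, c.total.left_inv hy] at key2
  unfold dproj dtotalInv dbaseInv
  rw [← c.fst_eq y hy]
  exact key2

theorem dtotalInv_mem_vert {y : Y} (hy : y ∈ c.total.source) (v : Euc m) :
    c.dtotalInv y (0, v) ∈ Vert n m π y := by
  rw [LinearMap.mem_ker]
  exact (dproj_dtotalInv hy _).trans (map_zero _)

variable (c)

open Classical in
/-- The vertical coordinate vectors `∂_i` in `V_y Y`, for `y` in the domain of the chart. -/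
def vertFrame (y : Y) (i : Fin m) : Vert n m π y :=
  if h : c.dtotalInv y (0, bvec i) ∈ Vert n m π y then ⟨_, h⟩ else 0

/-- The jet at `y` with coordinates `y^i_l = v l i`: it sends `∂_l` to `∂_l + y^i_l ∂_i`. -/
def jetOf (y : Y) (hy : y ∈ c.total.source) (v : Arr n m) : JetAt n m π y :=
  ⟨(c.dtotalInv y).comp (((ContinuousLinearMap.id ℝ (Euc n)).prod
      (∑ l, (EuclideanSpace.proj l : Euc n →L[ℝ] ℝ).smulRight (v l))).comp (c.dbase (π y))), by
    ext1 ξ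
    exact (dproj_dtotalInv hy _).trans (dbaseInv_dbase (c.mapsTo y hy) ξ)⟩

/-- The jet coordinates `(y^i_l)` of a jet at `y`. -/
def jetCoord (y : Y) (Γ : JetAt n m π y) : Arr n m :=
  fun l => (c.dtotal y (Γ.1 (c.baseFrame (π y) l))).2

/-- The element of `Π_y` with coordinates `p^l_i = p l i`: it sends `σ` to `p^l_i σ^i_l ω`,
`ω = dx¹ ∧ ⋯ ∧ dxⁿ`. -/
def legOf (y : Y) (p : Arr n m) : LegAt n m π y :=
  ∑ l, ((innerSL ℝ (p l)).comp ((ContinuousLinearMap.snd ℝ (Euc n) (Euc m)).comp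
    ((c.dtotal y).comp ((Vert n m π y).subtypeL.comp
      (ContinuousLinearMap.apply ℝ (Vert n m π y) (c.baseFrame (π y) l)))))).smulRight
    ((stdVol n).compContinuousLinearMap (c.dbase (π y)))

/-- The point of `Π` with coordinates `u = (x^l, y^i, p^l_i)`. -/
def legPoint (u : (Euc n × Euc m) × Arr n m) : LegendreBundle n m π :=
  ⟨c.total.symm u.1, c.legOf (c.total.symm u.1) u.2⟩

/-- The momentum coordinates `(p^l_i)` of an element of `Π_y`: the coefficients in
`q (dx^l ⊗ ∂_i) = p^l_i ω`. -/
def momCoord (y : Y) (q : LegAt n m π y) : Arr n m :=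
  fun l => WithLp.toLp 2 fun i =>
    q (((EuclideanSpace.proj l : Euc n →L[ℝ] ℝ).comp (c.dbase (π y))).smulRight (c.vertFrame y i))
      (c.baseFrame (π y))

open Classical in
/-- The coordinate expression `ℒ (x^l, y^i, y^i_l)`, `L = ℒ ω`, of a map
`L : J¹Y → ⋀ⁿ T*X` over `X`. -/
def lagr (L : ∀ y : Y, JetAt n m π y → Euc n [⋀^Fin n]→L[ℝ] ℝ)
    (u : (Euc n × Euc m) × Arr n m) : ℝ :=
  if h : u.1 ∈ c.total.target then
    L (c.total.symm u.1) (c.jetOf (c.total.symm u.1) (c.total.map_target h) u.2)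
      (c.baseFrame (π (c.total.symm u.1)))
  else 0

/-- The coordinate expression `ℋ (x^l, y^i, p^l_i)` of a map `h : q ↦ p^l_i dy^i ∧ ω_l - ℋ ω`
that sends `q` in `Π_y` to an `n`-form on `T_y Y` lying over `q`. -/
def ham (h : ∀ y : Y, LegAt n m π y → (Euc n × Euc m) [⋀^Fin n]→L[ℝ] ℝ)
    (u : (Euc n × Euc m) × Arr n m) : ℝ :=
  -h (c.total.symm u.1) (c.legOf (c.total.symm u.1) u.2)
    (fun l => c.dtotalInv (c.total.symm u.1) (bvec l, 0))

end FibredChart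

/-! ### Lagrangians, Hamiltonian forms and the maps they define -/

variable (n m π) in
/-- A smooth first order Lagrangian `L = ℒ ω : J¹Y → ⋀ⁿ T*X`. -/
structure Lagrangian where
  toFun : ∀ y : Y, JetAt n m π y → Euc n [⋀^Fin n]→L[ℝ] ℝ
  smooth : ∀ c : FibredChart n m π,
    ContDiffOn ℝ ∞ (c.lagr toFun) (c.total.target ×ˢ Set.univ)

variable (n m π) in
/-- A Hamiltonian form `H = h^* Ξ_Y = p^l_i dy^i ∧ ω_l - ℋ ω` on `Π`, given by the smooth section
`h` of `Z_Y → Π`. Thus `H` at the point `q` of `Π_y` is the pull-back to `T_q Π` of the `n`-form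
`toFun y q` on `T_y Y`. -/
structure HamiltonianForm where
  toFun : ∀ y : Y, LegAt n m π y → (Euc n × Euc m) [⋀^Fin n]→L[ℝ] ℝ
  liesOver : ∀ (y : Y) (q : LegAt n m π y), LiesOver (toFun y q) q
  smooth : ∀ c : FibredChart n m π,
    ContDiffOn ℝ ∞ (c.ham toFun) (c.total.target ×ˢ Set.univ)

/-- The Legendre map `L̂ : J¹Y → Π` over `Y`: the derivative of `L` along the fibres of
`J¹Y → Y`. In coordinates, `p^l_i ∘ L̂ = ∂ℒ/∂y^i_l`. -/
def Lagrangian.legendreMap (L : Lagrangian n m π) (y : Y) (Γ : JetAt n m π y) : LegAt n m π y :=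
  fderiv ℝ (fun σ : Euc n →L[ℝ] Vert n m π y => L.toFun y (Γ.add σ)) 0

/-- The fibre over `y` of the Lagrangian constraint space `N_L = L̂ (J¹Y)`. -/
def Lagrangian.constraintAt (L : Lagrangian n m π) (y : Y) : Set (LegAt n m π y) :=
  Set.range (L.legendreMap y)

/-- The Lagrangian constraint space `N_L = L̂ (J¹Y)` in `Π`. -/
def Lagrangian.constraintSpace (L : Lagrangian n m π) : Set (LegendreBundle n m π) :=
  {q | q.mom ∈ L.constraintAt q.pt}

/-- The array of the derivatives `∂ℋ/∂p^l_i` at a point `q` of `Π_y`. -/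
def HamiltonianForm.momGrad (H : HamiltonianForm n m π) (c : FibredChart n m π) (y : Y)
    (q : LegAt n m π y) : Arr n m :=
  fun l => WithLp.toLp 2 fun i =>
    fderiv ℝ (c.ham H.toFun) (c.total y, c.momCoord y q) (0, bArr l i)

/-! ### Auxiliary facts: coordinate formulas, and the independence of the Hamiltonian map of the chart -/

namespace FibredChart
variable {c : FibredChart n m π}

theorem dtotalInv_dtotal {y : Y} (hy : y ∈ c.total.source) (v : Euc n × Euc m) :
    c.dtotalInv y (c.dtotal y v) = v :=
  congrArg (fun f => f v) (total_mdifferentiable.symm_comp_deriv hy)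

theorem dtotal_dtotalInv {y : Y} (hy : y ∈ c.total.source) (v : Euc n × Euc m) :
    c.dtotal y (c.dtotalInv y v) = v := by
  have h := total_mdifferentiable.comp_symm_deriv (c.total.map_source hy)
  rw [c.total.left_inv hy] at h
  exact congrArg (fun f => f v) h

theorem dbase_dbaseInv {x : X} (hx : x ∈ c.base.source) (v : Euc n) :
    c.dbase x (c.dbaseInv x v) = v := by
  have h := base_mdifferentiable.comp_symm_deriv (c.base.map_source hx)
  rw [c.base.left_inv hx] at h
  exact congrArg (fun f => f v) h

theorem dbase_dproj {y : Y} (hy : y ∈ c.total.source) (w : Euc n × Euc m) :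
    c.dbase (π y) (dproj n m π y w) = (c.dtotal y w).1 := by
  rw [← dtotalInv_dtotal hy w, dproj_dtotalInv hy, dbase_dbaseInv (c.mapsTo y hy),
    dtotal_dtotalInv hy]

theorem dproj_jet {y : Y} (Γ : JetAt n m π y) (v : Euc n) : dproj n m π y (Γ.1 v) = v :=
  congrArg (fun f => f v) Γ.2

theorem vertFrame_coe {y : Y} (hy : y ∈ c.total.source) (i : Fin m) :
    (c.vertFrame y i : Euc n × Euc m) = c.dtotalInv y (0, bvec i) := by
  rw [vertFrame, dif_pos (dtotalInv_mem_vert hy _)]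

theorem euc_sum {k : ℕ} (v : Euc k) : v = ∑ i, v i • bvec i := by
  ext j
  simp [Pi.single_apply]

theorem stdVol_std : stdVol n (fun l => bvec l) = 1 := by
  change (EuclideanSpace.basisFun (Fin n) ℝ).toBasis.det _ = 1
  have : (fun l : Fin n => (bvec l : Euc n)) = (EuclideanSpace.basisFun (Fin n) ℝ).toBasis := by
    ext l; simp
  rw [this, Module.Basis.det_self]

theorem form_eq {x : X} (hx : x ∈ c.base.source) (f : Euc n [⋀^Fin n]→L[ℝ] ℝ)
    (v : Fin n → Euc n) :
    f v = f (c.baseFrame x) * stdVol n (fun l => c.dbase x (v l)) := by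
  have h := AlternatingMap.eq_smul_basis_det (EuclideanSpace.basisFun (Fin n) ℝ).toBasis
    (f.compContinuousLinearMap (c.dbaseInv x)).toAlternatingMap
  have h2 := congrArg (fun g => g fun l => c.dbase x (v l)) h
  simp only [AlternatingMap.smul_apply, smul_eq_mul] at h2
  have e1 : (f.compContinuousLinearMap (c.dbaseInv x)).toAlternatingMap
      (fun l => c.dbase x (v l)) = f v := by
    change f (fun l => c.dbaseInv x (c.dbase x (v l))) = f v
    simp only [dbaseInv_dbase hx]
  have e2 : (f.compContinuousLinearMap (c.dbaseInv x)).toAlternatingMap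
      (EuclideanSpace.basisFun (Fin n) ℝ).toBasis = f (c.baseFrame x) := by
    change f (fun l => c.dbaseInv x ((EuclideanSpace.basisFun (Fin n) ℝ).toBasis l)) = _
    congr 1
    ext l
    simp [baseFrame]
  rw [e1, e2] at h2
  exact h2

theorem vert_sum {y : Y} (hy : y ∈ c.total.source) (u : Vert n m π y) :
    u = ∑ i, (c.dtotal y u).2 i • c.vertFrame y i := by
  have h1 : (c.dtotal y u).1 = 0 := by
    rw [← dbase_dproj hy]
    have : dproj n m π y u = 0 := u.2
    rw [this, map_zero]
  apply Subtype.ext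
  have h2 : c.dtotal y u = ∑ i, (c.dtotal y u).2 i • ((0 : Euc n), (bvec i : Euc m)) := by
    refine Prod.ext ?_ ?_
    · simp [h1, Prod.fst_sum]
    · simp only [Prod.snd_sum, Prod.smul_snd]
      exact euc_sum _
  have h3 := congrArg (c.dtotalInv y) h2
  rw [dtotalInv_dtotal hy] at h3
  refine h3.trans ?_
  simp only [map_sum, map_smul, Submodule.coe_sum, Submodule.coe_smul, vertFrame_coe hy]

theorem hom_apply {y : Y} (hy : y ∈ c.total.source) (q : LegAt n m π y)
    (u : Vert n m π y) (l : Fin n) :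
    q (((EuclideanSpace.proj l : Euc n →L[ℝ] ℝ).comp (c.dbase (π y))).smulRight u)
      (c.baseFrame (π y)) = ∑ i, c.momCoord y q l i * (c.dtotal y u).2 i := by
  have h : ((EuclideanSpace.proj l : Euc n →L[ℝ] ℝ).comp (c.dbase (π y))).smulRight u =
      ∑ i, (c.dtotal y u).2 i •
        ((EuclideanSpace.proj l : Euc n →L[ℝ] ℝ).comp (c.dbase (π y))).smulRight
          (c.vertFrame y i) := by
    conv_lhs => rw [vert_sum hy u]
    ext1 ξ
    simp [Finset.smul_sum, smul_smul, mul_comm]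
  rw [h]
  simp only [map_sum, map_smul, ContinuousAlternatingMap.sum_apply,
    ContinuousAlternatingMap.smul_apply, smul_eq_mul, momCoord]
  exact Finset.sum_congr rfl fun i _ => mul_comm _ _

theorem legOf_apply_frame {y : Y} (hy : y ∈ c.total.source) (p : Arr n m)
    (σ : Euc n →L[ℝ] Vert n m π y) :
    c.legOf y p σ (c.baseFrame (π y)) =
      ∑ l, inner ℝ (p l) (c.dtotal y (σ (c.baseFrame (π y) l))).2 := by
  have h : stdVol n (fun l => c.dbase (π y) (c.baseFrame (π y) l)) = 1 := by
    simp only [baseFrame, dbase_dbaseInv (c.mapsTo y hy)]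
    exact stdVol_std
  simp only [legOf, sum_apply, ContinuousAlternatingMap.sum_apply]
  refine Finset.sum_congr rfl fun l _ => ?_
  simp [ContinuousLinearMap.smulRight_apply, Function.comp_def, h]

theorem momCoord_legOf {y : Y} (hy : y ∈ c.total.source) (p : Arr n m) :
    c.momCoord y (c.legOf y p) = p := by
  funext l
  ext i
  simp only [momCoord]
  rw [legOf_apply_frame hy, Finset.sum_eq_single l]
  · simp [baseFrame, dbase_dbaseInv (c.mapsTo y hy), vertFrame_coe hy, dtotal_dtotalInv hy,
      EuclideanSpace.inner_single_right]
  · intro k _ hk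
    simp [baseFrame, dbase_dbaseInv (c.mapsTo y hy), hk.symm]
  · simp

theorem legOf_momCoord {y : Y} (hy : y ∈ c.total.source) (q : LegAt n m π y) :
    c.legOf y (c.momCoord y q) = q := by
  ext σ v
  rw [form_eq (c.mapsTo y hy) _ v, form_eq (c.mapsTo y hy) (q σ) v, legOf_apply_frame hy]
  congr 1
  have hσ : σ = ∑ l, ((EuclideanSpace.proj l : Euc n →L[ℝ] ℝ).comp (c.dbase (π y))).smulRight
      (σ (c.baseFrame (π y) l)) := by
    ext1 ξ
    conv_lhs => rw [← dbaseInv_dbase (c.mapsTo y hy) ξ, euc_sum (c.dbase (π y) ξ)]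
    simp [baseFrame]
  conv_rhs => rw [hσ]
  simp only [map_sum, ContinuousAlternatingMap.sum_apply]
  refine Finset.sum_congr rfl fun l _ => ?_
  rw [hom_apply hy]
  simp [PiLp.inner_apply, mul_comm]

theorem jetCoord_jetOf {y : Y} (hy : y ∈ c.total.source) (v : Arr n m) :
    c.jetCoord y (c.jetOf y hy v) = v := by
  funext l
  simp only [jetCoord, jetOf, ContinuousLinearMap.comp_apply, dtotal_dtotalInv hy, baseFrame,
    dbase_dbaseInv (c.mapsTo y hy)]
  ext i
  simp [PiLp.single_apply]

/-- Contraction in the coordinate frame. -/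
theorem contr_frame {y : Y} (hy : y ∈ c.total.source) (q : LegAt n m π y)
    (u : Vert n m π y) (k : Fin n) :
    q.contr u k (c.baseFrame (π y)) = ∑ i, c.momCoord y q k i * (c.dtotal y u).2 i := by
  have hx := c.mapsTo y hy
  rw [← hom_apply hy, LegAt.contr]
  have h1 : ∀ l : Fin n,
      q ((EuclideanSpace.proj l : Euc n →L[ℝ] ℝ).smulRight u)
        (Function.update (c.baseFrame (π y)) k (bvec l)) =
      (c.dbase (π y) (bvec l)) k *
        q ((EuclideanSpace.proj l : Euc n →L[ℝ] ℝ).smulRight u) (c.baseFrame (π y)) := by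
    intro l
    set f := q ((EuclideanSpace.proj l : Euc n →L[ℝ] ℝ).smulRight u)
    have h2 : (bvec l : Euc n) = ∑ j, (c.dbase (π y) (bvec l)) j • c.baseFrame (π y) j := by
      conv_lhs => rw [← dbaseInv_dbase hx (bvec l), euc_sum (c.dbase (π y) (bvec l))]
      simp [baseFrame]
    conv_lhs => rw [h2]
    have h4 := f.toMultilinearMap.map_update_sum Finset.univ k
      (fun j => (c.dbase (π y) (bvec l)) j • c.baseFrame (π y) j) (c.baseFrame (π y))
    refine h4.trans ?_
    change ∑ j, f (Function.update (c.baseFrame (π y)) k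
      ((c.dbase (π y) (bvec l)) j • c.baseFrame (π y) j)) = _
    rw [Finset.sum_eq_single k]
    · rw [ContinuousAlternatingMap.map_update_smul, Function.update_eq_self, smul_eq_mul]
    · intro j _ hj
      rw [ContinuousAlternatingMap.map_update_smul]
      rw [f.map_eq_zero_of_eq (i := k) (j := j) _ (by simp [Function.update_of_ne hj]) hj.symm,
        smul_zero]
    · simp
  simp only [h1]
  have h3 : ((EuclideanSpace.proj k : Euc n →L[ℝ] ℝ).comp (c.dbase (π y))).smulRight u =
      ∑ l, (c.dbase (π y) (bvec l)) k • (EuclideanSpace.proj l : Euc n →L[ℝ] ℝ).smulRight u := by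
    ext1 ξ
    have : (c.dbase (π y) ξ) k = ∑ l, (c.dbase (π y) (bvec l)) k * ξ l := by
      conv_lhs => rw [euc_sum ξ]
      simp [mul_comm]
    simp [this, Finset.sum_smul, smul_smul]
  rw [h3]
  simp [map_sum, ContinuousAlternatingMap.sum_apply]

theorem form_jet {y : Y} (hy : y ∈ c.total.source) (q : LegAt n m π y)
    (z : (Euc n × Euc m) [⋀^Fin n]→L[ℝ] ℝ) (hz : LiesOver z q) (Γ : JetAt n m π y) :
    z (fun l => Γ.1 (c.baseFrame (π y) l)) =
      ∑ l, ∑ i, c.momCoord y q l i * c.jetCoord y Γ l i +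
        z (fun l => c.dtotalInv y (bvec l, 0)) := by
  set P : Fin n → Euc n × Euc m := fun l => c.dtotalInv y (bvec l, 0) with hP
  have hPd : ∀ l, dproj n m π y (P l) = c.baseFrame (π y) l := fun l => dproj_dtotalInv hy _
  have hΓ : ∀ l, Γ.1 (c.baseFrame (π y) l) = P l + c.dtotalInv y (0, c.jetCoord y Γ l) := by
    intro l
    rw [← dtotalInv_dtotal hy (Γ.1 (c.baseFrame (π y) l)), hP, ← map_add]
    congr 1
    refine Prod.ext ?_ ?_
    · rw [← dbase_dproj hy, dproj_jet, baseFrame, dbase_dbaseInv (c.mapsTo y hy)]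
      simp
    · simp [jetCoord]
  have key : ∀ s : Finset (Fin n),
      z (s.piecewise (fun l => Γ.1 (c.baseFrame (π y) l)) P) =
        ∑ l ∈ s, ∑ i, c.momCoord y q l i * c.jetCoord y Γ l i + z P := by
    intro s
    induction s using Finset.induction_on with
    | empty => simp
    | insert k s hk ih =>
      rw [Finset.piecewise_insert, hΓ k, ContinuousAlternatingMap.map_update_add]
      have h1 : Function.update (s.piecewise (fun l => Γ.1 (c.baseFrame (π y) l)) P) k (P k) =
          s.piecewise (fun l => Γ.1 (c.baseFrame (π y) l)) P := by
        rw [Function.update_eq_self_iff]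
        simp [hk]
      have h2 := hz.proj_eq (s.piecewise (fun l => Γ.1 (c.baseFrame (π y) l)) P) k
        ⟨_, dtotalInv_mem_vert hy (c.jetCoord y Γ k)⟩
      have h3 : (fun j => dproj n m π y (s.piecewise (fun l => Γ.1 (c.baseFrame (π y) l)) P j)) =
          c.baseFrame (π y) := by
        funext j
        by_cases hj : j ∈ s
        · simp only [Finset.piecewise_eq_of_mem _ _ _ hj, dproj_jet]
        · simp only [Finset.piecewise_eq_of_notMem _ _ _ hj, hPd]
      rw [h3, contr_frame hy] at h2
      simp only [dtotal_dtotalInv hy] at h2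
      rw [h1, h2, ih, Finset.sum_insert hk]
      ring
  have := key Finset.univ
  rwa [Finset.piecewise_univ] at this

end FibredChart
open FibredChart

theorem sum_bArr (v : Arr n m) : v = ∑ l, ∑ i, v l i • bArr l i := by
  funext k
  ext j
  simp only [Finset.sum_apply, WithLp.ofLp_sum, bArr, Pi.smul_apply, PiLp.smul_apply, smul_eq_mul]
  rw [Finset.sum_eq_single k, Finset.sum_eq_single j]
  · simp
  · intro i _ hi; simp [hi.symm]
  · simp
  · intro l _ hl
    simp [hl.symm]
  · simp

theorem FibredChart.ham_apply {c : FibredChart n m π}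
    (h : ∀ y : Y, LegAt n m π y → (Euc n × Euc m) [⋀^Fin n]→L[ℝ] ℝ) {y : Y}
    (hy : y ∈ c.total.source) (p : Arr n m) :
    c.ham h (c.total y, p) = -h y (c.legOf y p) (fun l => c.dtotalInv y (bvec l, 0)) := by
  have : ∀ y', y' = y → -h y' (c.legOf y' p) (fun l => c.dtotalInv y' (bvec l, 0)) =
      -h y (c.legOf y p) (fun l => c.dtotalInv y (bvec l, 0)) := by
    rintro _ rfl; rfl
  exact this _ (c.total.left_inv hy)

/-- The function `p^l_i y^i_l - ℋ` of `p^l_i`. -/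
noncomputable def HamiltonianForm.aux (H : HamiltonianForm n m π) (c : FibredChart n m π) (y : Y)
    (Γ : JetAt n m π y) (p : Arr n m) : ℝ :=
  ∑ l, ∑ i, p l i * c.jetCoord y Γ l i - c.ham H.toFun (c.total y, p)

theorem HamiltonianForm.aux_eq (H : HamiltonianForm n m π) {c : FibredChart n m π} {y : Y}
    (hy : y ∈ c.total.source) (Γ : JetAt n m π y) (q : LegAt n m π y) :
    H.aux c y Γ (c.momCoord y q) =
      (H.toFun y q).compContinuousLinearMap Γ.1 (c.baseFrame (π y)) := by
  change _ = H.toFun y q (fun l => Γ.1 (c.baseFrame (π y) l))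
  rw [form_jet hy q _ (H.liesOver y q) Γ, aux, ham_apply _ hy, legOf_momCoord hy]
  ring

theorem HamiltonianForm.hasFDerivAt_aux (H : HamiltonianForm n m π) {c : FibredChart n m π} {y : Y}
    (hy : y ∈ c.total.source) (Γ : JetAt n m π y) (p : Arr n m) :
    ∃ D : Arr n m →L[ℝ] ℝ, HasFDerivAt (H.aux c y Γ) D p ∧ ∀ l i,
      D (bArr l i) = c.jetCoord y Γ l i -
        fderiv ℝ (c.ham H.toFun) (c.total y, p) (0, bArr l i) := by
  have hd : DifferentiableAt ℝ (c.ham H.toFun) (c.total y, p) :=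
    ((H.smooth c).contDiffAt ((c.total.open_target.prod isOpen_univ).mem_nhds
      ⟨c.total.map_source hy, trivial⟩)).differentiableAt (by simp)
  have h1 : HasFDerivAt (fun p : Arr n m => c.ham H.toFun (c.total y, p))
      ((fderiv ℝ (c.ham H.toFun) (c.total y, p)).comp
        (ContinuousLinearMap.inr ℝ (Euc n × Euc m) (Arr n m))) p :=
    hd.hasFDerivAt.comp p (hasFDerivAt_prodMk_right (c.total y) p)
  let A : Arr n m →L[ℝ] ℝ := ∑ l, ∑ i, (c.jetCoord y Γ l i) •
    ((EuclideanSpace.proj i : Euc m →L[ℝ] ℝ).comp (ContinuousLinearMap.proj l))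
  have hA : ∀ p : Arr n m, A p = ∑ l, ∑ i, p l i * c.jetCoord y Γ l i := by
    intro p
    simp [A, sum_apply, mul_comm]
  refine ⟨A - (fderiv ℝ (c.ham H.toFun) (c.total y, p)).comp
        (ContinuousLinearMap.inr ℝ (Euc n × Euc m) (Arr n m)), ?_, ?_⟩
  · refine (A.hasFDerivAt.sub h1).congr_of_eventuallyEq (Filter.Eventually.of_forall fun p' => ?_)
    simp only [aux, Pi.sub_apply, hA]
  · intro l i
    rw [sub_apply, hA]
    congr 1
    rw [Finset.sum_eq_single l, Finset.sum_eq_single i]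
    · simp [bArr]
    · intro j _ hj; simp [bArr, hj]
    · simp
    · intro k _ hk; simp [bArr, hk]
    · simp

theorem HamiltonianForm.jetCoord_eq_momGrad_iff (H : HamiltonianForm n m π)
    {c : FibredChart n m π} {y : Y} (hy : y ∈ c.total.source) (Γ : JetAt n m π y)
    (q : LegAt n m π y) :
    c.jetCoord y Γ = H.momGrad c y q ↔ HasFDerivAt (H.aux c y Γ) (0 : Arr n m →L[ℝ] ℝ) (c.momCoord y q) := by
  obtain ⟨D, hD, hD'⟩ := H.hasFDerivAt_aux hy Γ (c.momCoord y q)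
  constructor
  · intro h
    convert hD using 1
    ext1 v
    rw [sum_bArr v]
    simp only [map_sum, map_smul, hD']
    simp [h, momGrad]
  · intro h
    have h0 := hD.unique h
    funext l
    ext i
    have := hD' l i
    rw [h0, zero_apply] at this
    simp only [momGrad]
    linarith

theorem HamiltonianForm.jetCoord_eq_momGrad (H : HamiltonianForm n m π)
    {c c' : FibredChart n m π} {y : Y} (hy : y ∈ c.total.source) (hy' : y ∈ c'.total.source)
    (Γ : JetAt n m π y) (q : LegAt n m π y) (h : c.jetCoord y Γ = H.momGrad c y q) :
    c'.jetCoord y Γ = H.momGrad c' y q := by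
  rw [H.jetCoord_eq_momGrad_iff hy] at h
  rw [H.jetCoord_eq_momGrad_iff hy']
  let A : Arr n m →ₗ[ℝ] Arr n m :=
    { toFun := fun p => c.momCoord y (c'.legOf y p)
      map_add' := fun p p' => by
        funext l
        ext i
        simp [momCoord, legOf, add_mul, map_add, Finset.sum_add_distrib]
      map_smul' := fun a p => by
        funext l
        ext i
        simp [momCoord, legOf, Finset.mul_sum, mul_assoc] }
  let B : Arr n m →L[ℝ] Arr n m := A.toContinuousLinearMap
  have hB : B (c'.momCoord y q) = c.momCoord y q := by
    change c.momCoord y (c'.legOf y (c'.momCoord y q)) = _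
    rw [legOf_momCoord hy']
  set κ : ℝ := stdVol n (fun l => c.dbase (π y) (c'.baseFrame (π y) l)) with hκ
  have e : ∀ p : Arr n m, H.aux c' y Γ p = H.aux c y Γ (B p) * κ := by
    intro p
    change _ = H.aux c y Γ (c.momCoord y (c'.legOf y p)) * κ
    rw [H.aux_eq hy, ← form_eq (c.mapsTo y hy), ← H.aux_eq hy', momCoord_legOf hy']
  have h1 : HasFDerivAt (fun p => H.aux c y Γ (B p)) ((0 : Arr n m →L[ℝ] ℝ).comp B)
      (c'.momCoord y q) := by
    have h' : HasFDerivAt (H.aux c y Γ) (0 : Arr n m →L[ℝ] ℝ) (B (c'.momCoord y q)) := by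
      rw [hB]; exact h
    exact h'.comp (c'.momCoord y q) B.hasFDerivAt
  have h2 := h1.mul_const κ
  have h3 : H.aux c' y Γ = fun p => H.aux c y Γ (B p) * κ := funext e
  rw [h3]
  simpa using h2

section FibreBundle

variable [IsManifold 𝓘(ℝ, Euc n) ∞ X] [IsManifold 𝓘(ℝ, Euc n × Euc m) ∞ Y]
  {M : Type*} [TopologicalSpace M] [ChartedSpace (Euc m) M] [IsManifold 𝓘(ℝ, Euc m) ∞ M]

/-- The Hamiltonian map `Ĥ : Π → J¹Y` over `Y`, given by `y^i_l ∘ Ĥ = ∂ℋ/∂p^l_i` in a fibred chart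
at the point `y` (and then in any other one, see `HamiltonianForm.jetCoord_hamMap`). -/
def HamiltonianForm.hamMap (hπ : IsSmoothFibreBundle n m M π) (H : HamiltonianForm n m π) (y : Y)
    (q : LegAt n m π y) : JetAt n m π y :=
  (hπ.exists_fibredChart y).choose.jetOf y (hπ.exists_fibredChart y).choose_spec
    (H.momGrad (hπ.exists_fibredChart y).choose y q)

/-- The Hamiltonian map satisfies `y^i_l ∘ Ĥ = ∂ℋ/∂p^l_i` in every fibred chart. -/
theorem HamiltonianForm.jetCoord_hamMap (hπ : IsSmoothFibreBundle n m M π)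
    (H : HamiltonianForm n m π) (c : FibredChart n m π) {y : Y} (hy : y ∈ c.total.source)
    (q : LegAt n m π y) : c.jetCoord y (H.hamMap hπ y q) = H.momGrad c y q :=
  H.jetCoord_eq_momGrad (hπ.exists_fibredChart y).choose_spec hy _ q (jetCoord_jetOf _ _)

/-- `H` is weakly associated with `L`: the identity `L̂ ∘ Ĥ ∘ L̂ = L̂` holds, and the identity of
`n`-forms `H = H_Ĥ + Ĥ^* L`, `H_Ĥ = p^l_i dy^i ∧ ω_l - p^l_i (y^i_l ∘ Ĥ) ω`, holds at the points of
the Lagrangian constraint space `N_L`. -/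
structure WeaklyAssociated (hπ : IsSmoothFibreBundle n m M π) (H : HamiltonianForm n m π)
    (L : Lagrangian n m π) : Prop where
  legendre_ham_legendre : ∀ (y : Y) (Γ : JetAt n m π y),
    L.legendreMap y (H.hamMap hπ y (L.legendreMap y Γ)) = L.legendreMap y Γ
  eq_on_constraint : ∀ (y : Y), ∀ q ∈ L.constraintAt y, ∀ w : Fin n → Euc n × Euc m,
    H.toFun y q w = q.form (H.hamMap hπ y q) w +
      L.toFun y (H.hamMap hπ y q) (fun k => dproj n m π y (w k))

end FibreBundle

/-! ### Almost regular Lagrangians -/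

/-- The manifold topology of the Legendre bundle `Π`, given by the coordinates
`(x^l, y^i, p^l_i)`. -/
instance : TopologicalSpace (LegendreBundle n m π) :=
  ⨆ c : FibredChart n m π, TopologicalSpace.coinduced
    (fun u : c.total.target × Arr n m => c.legPoint (u.1, u.2))
    inferInstance

/-- The subset `N` of `Π`, with fibres `N_y`, is an imbedded subbundle of `Π → Y` with typical fibre
the manifold `W`: over a neighbourhood `U` of any point of `Y` there is a bijection
`U × W → N ∩ Π_U` over `U` which is smooth and has smooth inverse. -/
def IsImbeddedSubbundle (N : Set (LegendreBundle n m π)) (k : ℕ) (W : Type)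
    [TopologicalSpace W] [ChartedSpace (Euc k) W] : Prop :=
  ∀ y₀ : Y, ∃ U : Set Y, IsOpen U ∧ y₀ ∈ U ∧
    ∃ (Ψ : ∀ y : Y, W → LegAt n m π y) (ρ : LegendreBundle n m π → W),
      (∀ y ∈ U, ∀ w : W, ⟨y, Ψ y w⟩ ∈ N ∧ ρ ⟨y, Ψ y w⟩ = w) ∧
      (∀ q ∈ N, q.pt ∈ U → Ψ q.pt (ρ q) = q.mom) ∧
      ∀ c : FibredChart n m π,
        ContMDiffOn (𝓘(ℝ, Euc n × Euc m).prod 𝓘(ℝ, Euc k)) 𝓘(ℝ, Arr n m) ∞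
          (fun a : Y × W => c.momCoord a.1 (Ψ a.1 a.2)) ((U ∩ c.total.source) ×ˢ Set.univ) ∧
        ContMDiffOn 𝓘(ℝ, (Euc n × Euc m) × Arr n m) 𝓘(ℝ, Euc k) ∞
          (fun u : (Euc n × Euc m) × Arr n m => ρ (c.legPoint u))
          {u | u.1 ∈ c.total.target ∧ (c.legPoint u).pt ∈ U ∧ c.legPoint u ∈ N}

/-- The coordinate expression `(x^l, y^i, y^i_l) ↦ (x^l, y^i, ∂ℒ/∂y^i_l)` of the Legendre map. -/
def Lagrangian.legendreRep (L : Lagrangian n m π) (c : FibredChart n m π)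
    (u : (Euc n × Euc m) × Arr n m) : (Euc n × Euc m) × Arr n m :=
  (u.1, fun l => WithLp.toLp 2 fun i => fderiv ℝ (c.lagr L.toFun) u (0, bArr l i))

/-- `L` is almost regular: the constraint space `N_L` is a closed imbedded subbundle of `Π → Y`, and
`L̂ : J¹Y → N_L` is a fibred manifold (a surjective submersion; surjectivity holds by the definition
of `N_L`) with connected fibres. -/
structure Lagrangian.AlmostRegular (L : Lagrangian n m π) : Prop where
  isClosed : IsClosed L.constraintSpace
  subbundle_submersion : ∃ (k : ℕ) (W : Type) (_ : TopologicalSpace W)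
    (_ : ChartedSpace (Euc k) W),
    IsManifold 𝓘(ℝ, Euc k) ∞ W ∧ T2Space W ∧ SecondCountableTopology W ∧
    IsImbeddedSubbundle L.constraintSpace k W ∧
    -- the rank of `L̂` equals the dimension of `N_L`
    ∀ c : FibredChart n m π, ∀ u : (Euc n × Euc m) × Arr n m, u.1 ∈ c.total.target →
      Module.finrank ℝ (fderiv ℝ (L.legendreRep c) u).range = n + m + k
  isConnected_fibre : ∀ (y : Y) (Γ : JetAt n m π y),
    IsConnected {Γ' : JetAt n m π y | L.legendreMap y Γ' = L.legendreMap y Γ}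

/-! ### Sections -/

namespace FibredChart

variable (c : FibredChart n m π)

/-- The set of the coordinates of the points `x` at which the map `s : X → Y` takes its values in
the domain of the chart. -/
def dom (s : X → Y) : Set (Euc n) := {x | x ∈ c.base.target ∧ s (c.base.symm x) ∈ c.total.source}

/-- The coordinate expression `y^i ∘ s` of a section `s` of `Y → X`. -/
def rep (s : X → Y) (x : Euc n) : Euc m := (c.total (s (c.base.symm x))).2

/-- The coordinate expression `y^i_l ∘ s̄` of a section `s̄` of `J¹Y → X`. -/
def jetRep (s : X → JetBundle n m π) (x : Euc n) : Arr n m :=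
  c.jetCoord (s (c.base.symm x)).pt (s (c.base.symm x)).jet

/-- The coordinate expression `p^l_i ∘ r` of a section `r` of `Π → X`. -/
def momRep (r : X → LegendreBundle n m π) (x : Euc n) : Arr n m :=
  c.momCoord (r (c.base.symm x)).pt (r (c.base.symm x)).mom

end FibredChart

variable (n m π) in
/-- `s` is a smooth section of `Y → X`. -/
structure IsSection (s : X → Y) : Prop where
  proj_eq : ∀ x, π (s x) = x
  smooth : ContMDiff 𝓘(ℝ, Euc n) 𝓘(ℝ, Euc n × Euc m) ∞ s

/-- `s` is a smooth section of `J¹Y → X`. -/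
structure IsJetSection (s : X → JetBundle n m π) : Prop where
  isSection : IsSection n m π (fun x => (s x).pt)
  smooth : ∀ c : FibredChart n m π, ContDiffOn ℝ ∞ (c.jetRep s) (c.dom fun x => (s x).pt)

/-- `r` is a smooth section of `Π → X`. -/
structure IsLegendreSection (r : X → LegendreBundle n m π) : Prop where
  isSection : IsSection n m π (fun x => (r x).pt)
  smooth : ∀ c : FibredChart n m π, ContDiffOn ℝ ∞ (c.momRep r) (c.dom fun x => (r x).pt)

/-! ### The Hamilton, Euler-Lagrange and Cartan equations -/

/-- The section `r` of `Π → X` solves the covariant Hamilton equations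
`∂_l y^i = ∂ℋ/∂p^l_i`, `∂_l p^l_i = - ∂ℋ/∂y^i`. -/
def SolvesHamilton (H : HamiltonianForm n m π) (r : X → LegendreBundle n m π) : Prop :=
  ∀ c : FibredChart n m π, ∀ x ∈ c.dom (fun x => (r x).pt),
    (∀ (l : Fin n) (i : Fin m),
      fderiv ℝ (c.rep fun x => (r x).pt) x (bvec l) i =
        fderiv ℝ (c.ham H.toFun) ((x, c.rep (fun x => (r x).pt) x), c.momRep r x)
          (0, bArr l i)) ∧
    ∀ i : Fin m,
      ∑ l, fderiv ℝ (c.momRep r) x (bvec l) l i =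
        -fderiv ℝ (c.ham H.toFun) ((x, c.rep (fun x => (r x).pt) x), c.momRep r x)
          ((0, bvec i), 0)

/-- The coordinate expression of `π^l_i = ∂ℒ/∂y^i_l`. -/
def Lagrangian.mom (L : Lagrangian n m π) (c : FibredChart n m π) (l : Fin n) (i : Fin m)
    (u : (Euc n × Euc m) × Arr n m) : ℝ :=
  fderiv ℝ (c.lagr L.toFun) u (0, bArr l i)

/-- The total derivative `∂_l f + v^i_l ∂f/∂y^i + a^i_{lh} ∂f/∂y^i_h`, at the point
`u = (x^l, y^i, y^i_l)`, of a function `f` on `J¹Y`. For `v^i_l = y^i_l` and second order jet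
coordinates `a l h = (y^i_{lh})` it is `d_l f`, for `v^i_l = ŷ^i_l` it is `d̂_l f`. -/
def totalDeriv (f : (Euc n × Euc m) × Arr n m → ℝ) (u : (Euc n × Euc m) × Arr n m) (v : Arr n m)
    (a : Fin n → Arr n m) (l : Fin n) : ℝ :=
  fderiv ℝ f u ((bvec l, v l), a l)

/-- The section `s` of `Y → X` solves the Euler-Lagrange equations
`(∂_i - d_l ∂^l_i) ℒ = 0`, evaluated at `J²s`. -/
def SolvesEulerLagrange (L : Lagrangian n m π) (s : X → Y) : Prop :=
  ∀ c : FibredChart n m π, ∀ x ∈ c.dom s,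
    let v : Euc n → Arr n m := fun x' l => fderiv ℝ (c.rep s) x' (bvec l)
    let a : Fin n → Arr n m := fun l => fderiv ℝ v x (bvec l)
    let u : (Euc n × Euc m) × Arr n m := ((x, c.rep s x), v x)
    ∀ i : Fin m,
      fderiv ℝ (c.lagr L.toFun) u ((0, bvec i), 0) - ∑ l, totalDeriv (L.mom c l i) u (v x) a l = 0

/-- The section `s̄` of `J¹Y → X` solves the Cartan equations
`(ŷ^j_h - y^j_h) ∂π^h_j/∂y^i_l = 0`,
`∂_i ℒ - d̂_l π^l_i + (ŷ^j_l - y^j_l) ∂_i π^l_j = 0`, evaluated at `J¹s̄`, i.e. with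
`ŷ^i_l = ∂_l y^i` and `y^i_{lh} = ∂_l y^i_h`. -/
def SolvesCartan (L : Lagrangian n m π) (s : X → JetBundle n m π) : Prop :=
  ∀ c : FibredChart n m π, ∀ x ∈ c.dom (fun x => (s x).pt),
    let v : Arr n m := c.jetRep s x
    let vhat : Arr n m := fun l => fderiv ℝ (c.rep fun x => (s x).pt) x (bvec l)
    let a : Fin n → Arr n m := fun l => fderiv ℝ (c.jetRep s) x (bvec l)
    let u : (Euc n × Euc m) × Arr n m := ((x, c.rep (fun x => (s x).pt) x), v)
    (∀ (l : Fin n) (i : Fin m),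
      ∑ h, ∑ j, fderiv ℝ (L.mom c h j) u (0, bArr l i) * (vhat h j - v h j) = 0) ∧
    ∀ i : Fin m,
      fderiv ℝ (c.lagr L.toFun) u ((0, bvec i), 0) - ∑ l, totalDeriv (L.mom c l i) u vhat a l +
        ∑ l, ∑ j, (vhat l j - v l j) * fderiv ℝ (L.mom c l j) u ((0, bvec i), 0) = 0

end Polysymplectic

end

open Polysymplectic

/-!
Everything is local, so the argument takes place in a fibred chart. Write `g = ∂ℋ/∂p` for the
coordinate expression of `Ĥ` and `λ = ∂ℒ/∂v` for that of `L̂`, both as maps that keep the point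
`z = (x^l, y^i)` fixed. Weak association says that on the constraint space `N_L`

* `λ (z, g (z, p)) = p` (`WeaklyAssociated.fibreGrad_fibreGrad`), and
* `ℋ (z, p) = p · g (z, p) - ℒ (z, g (z, p))` (`WeaklyAssociated.ham_eq`); this is the equality of
  `n`-forms, evaluated on the horizontal frame of the jet `Ĥ q`, on which the contact part vanishes.

The key step is an envelope argument (`fderiv_eq_neg_fderiv_of_legendre`). The second identity may be
differentiated only along `N_L`, but `N_L` is the image of `L̂`, so through each of its points there
runs the section `z ↦ λ (z, v)` over a neighbourhood in `Y`, with constant `v`. Along it the terms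
with derivatives of `p` and `g` cancel because of `g = ∂ℋ/∂p` and of the first identity, and what
remains is `∂ℋ/∂y^i = - ∂ℒ/∂y^i ∘ Ĥ` on `N_L` (`WeaklyAssociated.fderiv_ham_eq`).

If `r` solves the Hamilton equations, the first of them says that `Ĥ ∘ r` is the jet prolongation of
the projection `s` of `r` to `Y` (`SolvesHamilton.jetRep_hamMap`), so that `r = L̂ ∘ J¹s` when `r`
takes its values in `N_L` (`SolvesHamilton.fibreGrad_prolongRep`). Therefore
`d_l π^l_i = ∂_l p^l_i = - ∂ℋ/∂y^i = ∂ℒ/∂y^i` along `J¹s`, which is the Euler-Lagrange equation.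
On a jet prolongation `ŷ^i_l = y^i_l`, and the Cartan equations reduce to the Euler-Lagrange
equations (`SolvesEulerLagrange.solvesCartan`).
-/

namespace Polysymplectic

/-! ### The derivative along the fibres and the envelope identity -/

/-- Envelope identity: if `h (z, p z) = p z · g z - f (z, g z)` along `z ↦ p z`, where `g = ∂h/∂p`
and `p = ∂f/∂v`, then the partial derivatives of `h` and `-f` along the base agree, because the
derivatives of `p` and `g` cancel. -/
theorem fderiv_eq_neg_fderiv_of_legendre {E P V : Type*}
    [NormedAddCommGroup E] [NormedSpace ℝ E] [NormedAddCommGroup P] [NormedSpace ℝ P]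
    [NormedAddCommGroup V] [NormedSpace ℝ V] (B : P →L[ℝ] V →L[ℝ] ℝ)
    {f : E × V → ℝ} {h : E × P → ℝ} {p : E → P} {g : E → V} {z : E}
    (hf : DifferentiableAt ℝ f (z, g z)) (hh : DifferentiableAt ℝ h (z, p z))
    (hp : DifferentiableAt ℝ p z) (hg : DifferentiableAt ℝ g z)
    (hfv : ∀ b, fderiv ℝ f (z, g z) (0, b) = B (p z) b)
    (hhp : ∀ a, fderiv ℝ h (z, p z) (0, a) = B a (g z))
    (heq : ∀ᶠ z' in nhds z, h (z', p z') = B (p z') (g z') - f (z', g z')) (w : E) :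
    fderiv ℝ h (z, p z) (w, 0) = -fderiv ℝ f (z, g z) (w, 0) := by
  have h1 : HasFDerivAt (fun z' => h (z', p z'))
      ((fderiv ℝ h (z, p z)).comp ((ContinuousLinearMap.id ℝ E).prod (fderiv ℝ p z))) z :=
    HasFDerivAt.comp z (f := fun z' => (z', p z')) hh.hasFDerivAt
      ((hasFDerivAt_id z).prodMk hp.hasFDerivAt)
  have h2 : HasFDerivAt (fun z' => f (z', g z'))
      ((fderiv ℝ f (z, g z)).comp ((ContinuousLinearMap.id ℝ E).prod (fderiv ℝ g z))) z :=
    HasFDerivAt.comp z (f := fun z' => (z', g z')) hf.hasFDerivAt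
      ((hasFDerivAt_id z).prodMk hg.hasFDerivAt)
  have h3 := (B.hasFDerivAt_of_bilinear hp.hasFDerivAt hg.hasFDerivAt).sub h2
  have h4 := congrArg (fun D => D w) (h1.unique (h3.congr_of_eventuallyEq heq))
  simp only [ContinuousLinearMap.comp_apply, ContinuousLinearMap.prod_apply,
    ContinuousLinearMap.id_apply, sub_apply, add_apply, ContinuousLinearMap.precompL_apply] at h4
  have e1 : ∀ a : P, ((w, a) : E × P) = (w, 0) + (0, a) := by simp
  have e2 : ∀ b : V, ((w, b) : E × V) = (w, 0) + (0, b) := by simp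
  have e3 : B.precompR E (p z) (fderiv ℝ g z) w = B (p z) (fderiv ℝ g z w) := rfl
  rw [e1, e2, map_add, map_add, hfv, hhp] at h4
  linarith

theorem hasFDerivAt_comp_affine {E V S : Type*}
    [NormedAddCommGroup E] [NormedSpace ℝ E] [NormedAddCommGroup V] [NormedSpace ℝ V]
    [NormedAddCommGroup S] [NormedSpace ℝ S] {f : E × V → ℝ} (z : E) (v : V) (A : S →L[ℝ] V)
    (hf : DifferentiableAt ℝ f (z, v)) :
    HasFDerivAt (fun σ => f (z, v + A σ))
      ((fderiv ℝ f (z, v)).comp ((ContinuousLinearMap.inr ℝ E V).comp A)) 0 := by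
  have h : HasFDerivAt (fun σ => (z, v + A σ)) ((ContinuousLinearMap.inr ℝ E V).comp A) 0 :=
    HasFDerivAt.comp (0 : S) (hasFDerivAt_prodMk_right z (v + A 0)) (A.hasFDerivAt.const_add v)
  have hf' : HasFDerivAt f (fderiv ℝ f (z, v)) (z, v + A 0) := by
    simpa using hf.hasFDerivAt
  exact HasFDerivAt.comp (0 : S) (f := fun σ => (z, v + A σ)) hf' h

variable {n m : ℕ}

/-- The pairing `p^l_i v^i_l` of momentum and jet coordinates. -/
noncomputable def pairing (n m : ℕ) : Arr n m →L[ℝ] Arr n m →L[ℝ] ℝ :=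
  ∑ l, (innerSL ℝ).bilinearComp (ContinuousLinearMap.proj l) (ContinuousLinearMap.proj l)

theorem pairing_apply (p v : Arr n m) : pairing n m p v = ∑ l, ∑ i, p l i * v l i := by
  simp [pairing, sum_apply, PiLp.inner_apply, mul_comm]

theorem pairing_comm (p v : Arr n m) : pairing n m p v = pairing n m v p := by
  simp only [pairing_apply, mul_comm]

/-- The array `∂f/∂v^i_l` of the partial derivatives of `f (x^l, y^i, v^i_l)` in the fibre
coordinates `v^i_l`. -/
noncomputable def fibreGrad (f : (Euc n × Euc m) × Arr n m → ℝ) (u : (Euc n × Euc m) × Arr n m) :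
    Arr n m :=
  fun l => WithLp.toLp 2 fun i => fderiv ℝ f u (0, bArr l i)

theorem fderiv_fibre (f : (Euc n × Euc m) × Arr n m → ℝ) (u : (Euc n × Euc m) × Arr n m)
    (a : Arr n m) : fderiv ℝ f u (0, a) = pairing n m (fibreGrad f u) a := by
  let D := (fderiv ℝ f u).comp (ContinuousLinearMap.inr ℝ (Euc n × Euc m) (Arr n m))
  have h : D a = ∑ l, ∑ i, a l i * D (bArr l i) := by
    conv_lhs => rw [sum_bArr a]
    simp only [map_sum, map_smul, smul_eq_mul]
  rw [pairing_comm, pairing_apply]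
  exact h

theorem contDiffOn_fibreGrad {f : (Euc n × Euc m) × Arr n m → ℝ}
    {s : Set ((Euc n × Euc m) × Arr n m)} (hs : IsOpen s) (hf : ContDiffOn ℝ ∞ f s) :
    ContDiffOn ℝ ∞ (fibreGrad f) s := by
  have h := hf.fderiv_of_isOpen hs (m := ∞) (by simp)
  refine contDiffOn_pi.2 fun l => ?_
  rw [contDiffOn_euclidean]
  exact fun i => h.clm_apply contDiffOn_const

variable {X Y : Type*}
  [TopologicalSpace X] [ChartedSpace (Euc n) X]
  [TopologicalSpace Y] [ChartedSpace (Euc n × Euc m) Y] {π : Y → X}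

/-! ### Coordinate expressions of the Legendre map and of the Hamiltonian form -/

namespace FibredChart

variable {c : FibredChart n m π}

theorem jetOf_jetCoord {y : Y} (hy : y ∈ c.total.source) (Γ : JetAt n m π y) :
    c.jetOf y hy (c.jetCoord y Γ) = Γ := by
  apply Subtype.ext
  ext1 ξ
  have hξ : ξ = ∑ l, c.dbase (π y) ξ l • c.baseFrame (π y) l := by
    conv_lhs => rw [← dbaseInv_dbase (c.mapsTo y hy) ξ, euc_sum (c.dbase (π y) ξ)]
    simp [baseFrame]
  rw [← dtotalInv_dtotal hy (Γ.1 ξ)]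
  change c.dtotalInv y _ = _
  congr 1
  refine Prod.ext ?_ ?_
  · rw [← dbase_dproj hy, dproj_jet]
    rfl
  · conv_rhs => rw [hξ]
    simp [jetCoord, Prod.snd_sum]

/-- `y^i_l (Γ + σ) = y^i_l (Γ) + σ^i_l`: jet coordinates are affine. -/
theorem jetCoord_add {y : Y} (Γ : JetAt n m π y) (σ : Euc n →L[ℝ] Vert n m π y) (l : Fin n) :
    c.jetCoord y (Γ.add σ) l =
      c.jetCoord y Γ l + (c.dtotal y (σ (c.baseFrame (π y) l))).2 := by
  simp [jetCoord, JetAt.add]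

/-- `lagr`, defined at points of the chart target, is the `ω`-coefficient of `L` at every jet `Γ`
over the chart domain. -/
theorem lagr_jetCoord (L : ∀ y : Y, JetAt n m π y → Euc n [⋀^Fin n]→L[ℝ] ℝ) {y : Y}
    (hy : y ∈ c.total.source) (Γ : JetAt n m π y) :
    c.lagr L (c.total y, c.jetCoord y Γ) = L y Γ (c.baseFrame (π y)) := by
  have key : ∀ y' (hy' : y' ∈ c.total.source), y' = y →
      L y' (c.jetOf y' hy' (c.jetCoord y Γ)) (c.baseFrame (π y')) =
        L y Γ (c.baseFrame (π y)) := by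
    rintro _ _ rfl
    rw [jetOf_jetCoord]
  rw [lagr, dif_pos (c.total.map_source hy)]
  exact key _ _ (c.total.left_inv hy)

end FibredChart
open FibredChart

theorem Lagrangian.differentiableAt_lagr (L : Lagrangian n m π) (c : FibredChart n m π)
    {u : (Euc n × Euc m) × Arr n m} (hu : u.1 ∈ c.total.target) :
    DifferentiableAt ℝ (c.lagr L.toFun) u :=
  ((L.smooth c).contDiffAt ((c.total.open_target.prod isOpen_univ).mem_nhds
    ⟨hu, trivial⟩)).differentiableAt (by simp)

theorem HamiltonianForm.differentiableAt_ham (H : HamiltonianForm n m π) (c : FibredChart n m π)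
    {u : (Euc n × Euc m) × Arr n m} (hu : u.1 ∈ c.total.target) :
    DifferentiableAt ℝ (c.ham H.toFun) u :=
  ((H.smooth c).contDiffAt ((c.total.open_target.prod isOpen_univ).mem_nhds
    ⟨hu, trivial⟩)).differentiableAt (by simp)

theorem Lagrangian.differentiableAt_fibreGrad (L : Lagrangian n m π) (c : FibredChart n m π)
    {u : (Euc n × Euc m) × Arr n m} (hu : u.1 ∈ c.total.target) :
    DifferentiableAt ℝ (fibreGrad (c.lagr L.toFun)) u :=
  ((contDiffOn_fibreGrad (c.total.open_target.prod isOpen_univ) (L.smooth c)).contDiffAt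
    ((c.total.open_target.prod isOpen_univ).mem_nhds ⟨hu, trivial⟩)).differentiableAt (by simp)

theorem HamiltonianForm.differentiableAt_fibreGrad (H : HamiltonianForm n m π)
    (c : FibredChart n m π) {u : (Euc n × Euc m) × Arr n m} (hu : u.1 ∈ c.total.target) :
    DifferentiableAt ℝ (fibreGrad (c.ham H.toFun)) u :=
  ((contDiffOn_fibreGrad (c.total.open_target.prod isOpen_univ) (H.smooth c)).contDiffAt
    ((c.total.open_target.prod isOpen_univ).mem_nhds ⟨hu, trivial⟩)).differentiableAt (by simp)

/-- In coordinates, `p^l_i ∘ L̂ = ∂ℒ/∂y^i_l`. -/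
theorem Lagrangian.momCoord_legendreMap (L : Lagrangian n m π) {c : FibredChart n m π} {y : Y}
    (hy : y ∈ c.total.source) (Γ : JetAt n m π y) :
    c.momCoord y (L.legendreMap y Γ) =
      fibreGrad (c.lagr L.toFun) (c.total y, c.jetCoord y Γ) := by
  have hx := c.mapsTo y hy
  -- the linear part of the affine map `σ ↦ (y^i_l (Γ + σ))`
  let A : (Euc n →L[ℝ] Vert n m π y) →L[ℝ] Arr n m := ContinuousLinearMap.pi fun l =>
    (ContinuousLinearMap.snd ℝ (Euc n) (Euc m)).comp ((c.dtotal y).comp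
      ((Vert n m π y).subtypeL.comp
        (ContinuousLinearMap.apply ℝ (Vert n m π y) (c.baseFrame (π y) l))))
  have hA : ∀ σ, c.jetCoord y (Γ.add σ) = c.jetCoord y Γ + A σ := fun σ =>
    funext fun l => jetCoord_add Γ σ l
  set vol := (stdVol n).compContinuousLinearMap (c.dbase (π y))
  have hL : (fun σ : Euc n →L[ℝ] Vert n m π y => L.toFun y (Γ.add σ)) =
      fun σ => c.lagr L.toFun (c.total y, c.jetCoord y Γ + A σ) • vol := by
    funext σ
    ext v
    rw [form_eq hx _ v, ← lagr_jetCoord L.toFun hy, hA]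
    rfl
  have h3 := (hasFDerivAt_comp_affine (S := Euc n →L[ℝ] Vert n m π y)
    (c.total y) (c.jetCoord y Γ) A (L.differentiableAt_lagr c (c.total.map_source hy))).smul_const vol
  have h4 : ∀ σ, L.legendreMap y Γ σ =
      fderiv ℝ (c.lagr L.toFun) (c.total y, c.jetCoord y Γ) (0, A σ) • vol := fun σ => by
    rw [Lagrangian.legendreMap, hL, h3.fderiv]
    rfl
  have hvol : vol (c.baseFrame (π y)) = 1 := by
    change stdVol n (fun l => c.dbase (π y) (c.baseFrame (π y) l)) = 1
    simp only [baseFrame, dbase_dbaseInv hx]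
    exact stdVol_std
  funext l
  ext i
  have hb : A (((EuclideanSpace.proj l : Euc n →L[ℝ] ℝ).comp (c.dbase (π y))).smulRight
      (c.vertFrame y i)) = bArr l i := by
    funext k
    change (c.dtotal y (((EuclideanSpace.proj l : Euc n →L[ℝ] ℝ)
      (c.dbase (π y) (c.dbaseInv (π y) (bvec k)))) • (c.vertFrame y i : Euc n × Euc m))).2 = _
    rw [dbase_dbaseInv hx, vertFrame_coe hy, map_smul, dtotal_dtotalInv hy]
    by_cases hk : k = l
    · subst hk; simp [bArr]
    · simp [bArr, hk, Ne.symm hk]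
  simp only [momCoord, h4, fibreGrad, ContinuousAlternatingMap.smul_apply, hvol, hb, smul_eq_mul,
    mul_one]

section FibreBundle

variable [IsManifold 𝓘(ℝ, Euc n) ∞ X] [IsManifold 𝓘(ℝ, Euc n × Euc m) ∞ Y]
  {M : Type*} [TopologicalSpace M] [ChartedSpace (Euc m) M] [IsManifold 𝓘(ℝ, Euc m) ∞ M]
  {hπ : IsSmoothFibreBundle n m M π} {H : HamiltonianForm n m π} {L : Lagrangian n m π}

/-- In coordinates, `L̂ ∘ Ĥ = id` on the constraint space. -/
theorem WeaklyAssociated.fibreGrad_fibreGrad (hHL : WeaklyAssociated hπ H L)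
    (c : FibredChart n m π) {y : Y} (hy : y ∈ c.total.source) {q : LegAt n m π y}
    (hq : q ∈ L.constraintAt y) :
    fibreGrad (c.lagr L.toFun)
      (c.total y, fibreGrad (c.ham H.toFun) (c.total y, c.momCoord y q)) = c.momCoord y q := by
  obtain ⟨Γ, rfl⟩ := hq
  have h := congrArg (c.momCoord y) (hHL.legendre_ham_legendre y Γ)
  rwa [L.momCoord_legendreMap hy (H.hamMap hπ y (L.legendreMap y Γ)),
    H.jetCoord_hamMap hπ c hy] at h

/-- In coordinates, `ℋ = p^l_i ∂ℋ/∂p^l_i - ℒ ∘ Ĥ` on the constraint space. -/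
theorem WeaklyAssociated.ham_eq (hHL : WeaklyAssociated hπ H L) (c : FibredChart n m π) {y : Y}
    (hy : y ∈ c.total.source) {q : LegAt n m π y} (hq : q ∈ L.constraintAt y) :
    c.ham H.toFun (c.total y, c.momCoord y q) =
      pairing n m (c.momCoord y q) (fibreGrad (c.ham H.toFun) (c.total y, c.momCoord y q)) -
      c.lagr L.toFun (c.total y, fibreGrad (c.ham H.toFun) (c.total y, c.momCoord y q)) := by
  set Γ := H.hamMap hπ y q with hΓ
  have hc : c.jetCoord y Γ = fibreGrad (c.ham H.toFun) (c.total y, c.momCoord y q) :=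
    H.jetCoord_hamMap hπ c hy q
  have h := hHL.eq_on_constraint y q hq (fun l => Γ.1 (c.baseFrame (π y) l))
  -- the contact form `dy^i - y^i_l dx^l` of the jet `Γ` vanishes on the image of `Γ`
  have h0 : ∀ v, Γ.vertPart (Γ.1 v) = 0 := fun v => Subtype.ext (by
    change Γ.1 v - Γ.1 (dproj n m π y (Γ.1 v)) = 0
    rw [dproj_jet, sub_self])
  have h1 : q.form Γ (fun l => Γ.1 (c.baseFrame (π y) l)) = 0 := by
    refine Finset.sum_eq_zero fun k _ => Finset.sum_eq_zero fun l _ => ?_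
    rw [h0, ContinuousLinearMap.smulRight_zero, map_zero]
    rfl
  simp only [dproj_jet] at h
  rw [h1, zero_add, form_jet hy q _ (H.liesOver y q) Γ, ← lagr_jetCoord L.toFun hy, hc] at h
  rw [ham_apply _ hy, legOf_momCoord hy, pairing_apply, ← h]
  ring

/-- On the constraint space, `∂ℋ/∂y^i = - ∂ℒ/∂y^i ∘ Ĥ`. -/
theorem WeaklyAssociated.fderiv_ham_eq (hHL : WeaklyAssociated hπ H L) (c : FibredChart n m π)
    {y : Y} (hy : y ∈ c.total.source) {q : LegAt n m π y} (hq : q ∈ L.constraintAt y)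
    (w : Euc n × Euc m) :
    fderiv ℝ (c.ham H.toFun) (c.total y, c.momCoord y q) (w, 0) =
      -fderiv ℝ (c.lagr L.toFun)
        (c.total y, fibreGrad (c.ham H.toFun) (c.total y, c.momCoord y q)) (w, 0) := by
  have hz := c.total.map_source hy
  have hp : c.momCoord y q ∈ Set.range fun v => fibreGrad (c.lagr L.toFun) (c.total y, v) := by
    obtain ⟨Γ, rfl⟩ := hq
    exact ⟨_, (L.momCoord_legendreMap hy Γ).symm⟩
  obtain ⟨v, hv⟩ := hp
  -- the local section of the constraint space given by jets with constant coordinates `v`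
  set p : Euc n × Euc m → Arr n m := fun z => fibreGrad (c.lagr L.toFun) (z, v) with hpd
  have hv' : p (c.total y) = c.momCoord y q := hv
  have hpdiff : DifferentiableAt ℝ p (c.total y) :=
    DifferentiableAt.comp (c.total y) (f := fun z => (z, v))
      (L.differentiableAt_fibreGrad c hz) (by fun_prop)
  have hgdiff : DifferentiableAt ℝ (fun z => fibreGrad (c.ham H.toFun) (z, p z)) (c.total y) :=
    DifferentiableAt.comp (c.total y) (f := fun z => (z, p z))
      (H.differentiableAt_fibreGrad c hz) (by fun_prop)
  rw [← hv']
  refine fderiv_eq_neg_fderiv_of_legendre (pairing n m)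
    (g := fun z => fibreGrad (c.ham H.toFun) (z, p z)) (L.differentiableAt_lagr c hz)
    (H.differentiableAt_ham c hz) hpdiff hgdiff (fun b => ?_) (fun a => ?_) ?_ w
  · have h := hHL.fibreGrad_fibreGrad c hy hq
    rw [← hv'] at h
    exact (fderiv_fibre _ _ b).trans (congrArg (fun a => pairing n m a b) h)
  · rw [fderiv_fibre, pairing_comm]
  · filter_upwards [c.total.open_target.mem_nhds hz] with z hz'
    have hy' := c.total.map_target hz'
    have h := hHL.ham_eq c hy' (Set.mem_range_self (c.jetOf _ hy' v))
    rwa [L.momCoord_legendreMap hy', jetCoord_jetOf, c.total.right_inv hz'] at h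

end FibreBundle

/-! ### Sections in coordinates -/

namespace FibredChart

variable {c : FibredChart n m π} {s : X → Y}

theorem isOpen_dom (hs : Continuous s) : IsOpen (c.dom s) := by
  have h := c.base.symm.isOpen_inter_preimage (c.total.open_source.preimage hs)
  exact h

theorem total_eq (hs : ∀ x, π (s x) = x) {x : Euc n} (hx : x ∈ c.dom s) :
    c.total (s (c.base.symm x)) = (x, c.rep s x) := by
  refine Prod.ext ?_ rfl
  rw [c.fst_eq _ hx.2, hs, c.base.right_inv hx.1]

theorem contDiffOn_rep (hs : ContMDiff 𝓘(ℝ, Euc n) 𝓘(ℝ, Euc n × Euc m) ∞ s) :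
    ContDiffOn ℝ ∞ (c.rep s) (c.dom s) := by
  have h1 : ContMDiffOn 𝓘(ℝ, Euc n) 𝓘(ℝ, Euc n) ∞ c.base.symm (c.dom s) :=
    (contMDiffOn_symm_of_mem_maximalAtlas c.base_mem).mono fun x hx => hx.1
  have h2 := (contMDiffOn_of_mem_maximalAtlas c.total_mem).comp (hs.comp_contMDiffOn h1)
    fun x hx => hx.2
  exact contDiff_snd.comp_contDiffOn h2.contDiffOn

variable (c) in
/-- The jet coordinates `∂_l y^i` of the first jet prolongation of a section `s` of `Y → X`. -/
noncomputable def prolongRep (s : X → Y) (x : Euc n) : Arr n m :=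
  fun l => fderiv ℝ (c.rep s) x (bvec l)

theorem contDiffOn_prolongRep (hs : ContMDiff 𝓘(ℝ, Euc n) 𝓘(ℝ, Euc n × Euc m) ∞ s) :
    ContDiffOn ℝ ∞ (c.prolongRep s) (c.dom s) := by
  have h := (contDiffOn_rep (c := c) hs).fderiv_of_isOpen (isOpen_dom hs.continuous) (m := ∞)
    (by simp)
  exact contDiffOn_pi.2 fun l => h.clm_apply contDiffOn_const

/-- A total derivative is the derivative of the composite with a jet prolongation. -/
theorem totalDeriv_prolongRep (hs : ContMDiff 𝓘(ℝ, Euc n) 𝓘(ℝ, Euc n × Euc m) ∞ s) {x : Euc n}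
    (hx : x ∈ c.dom s) {f : (Euc n × Euc m) × Arr n m → ℝ}
    (hf : DifferentiableAt ℝ f ((x, c.rep s x), c.prolongRep s x)) (l : Fin n) :
    totalDeriv f ((x, c.rep s x), c.prolongRep s x) (c.prolongRep s x)
      (fun l => fderiv ℝ (c.prolongRep s) x (bvec l)) l =
      fderiv ℝ (fun x' => f ((x', c.rep s x'), c.prolongRep s x')) x (bvec l) := by
  have hdom := (isOpen_dom (c := c) hs.continuous).mem_nhds hx
  have h1 := (((contDiffOn_rep hs).contDiffAt hdom).differentiableAt (by simp)).hasFDerivAt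
  have h2 := (((contDiffOn_prolongRep hs).contDiffAt hdom).differentiableAt (by simp)).hasFDerivAt
  have h3 : HasFDerivAt (fun x' => f ((x', c.rep s x'), c.prolongRep s x')) _ x :=
    HasFDerivAt.comp x (f := fun x' => ((x', c.rep s x'), c.prolongRep s x')) hf.hasFDerivAt
      (((hasFDerivAt_id x).prodMk h1).prodMk h2)
  rw [h3.fderiv]
  rfl

end FibredChart

/-! ### Solutions of the Hamilton equations -/

/-- The first Hamilton equation: the jet prolongation of the projection of `r` to `Y` has the
coordinates `∂ℋ/∂p^l_i` at `r`. -/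
theorem SolvesHamilton.prolongRep_eq {H : HamiltonianForm n m π} {r : X → LegendreBundle n m π}
    (hrH : SolvesHamilton H r) {c : FibredChart n m π} {x : Euc n}
    (hx : x ∈ c.dom fun x => (r x).pt) :
    c.prolongRep (fun x => (r x).pt) x =
      fibreGrad (c.ham H.toFun) ((x, c.rep (fun x => (r x).pt) x), c.momRep r x) := by
  funext l
  ext i
  exact (hrH c x hx).1 l i

/-- On the jet prolongation of a section of `Y → X` one has `ŷ^i_l = y^i_l`, and there the Cartan
equations reduce to the Euler-Lagrange equations. -/
theorem SolvesEulerLagrange.solvesCartan {L : Lagrangian n m π} {s : X → JetBundle n m π}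
    (hs : Continuous fun x => (s x).pt) (hsL : SolvesEulerLagrange L fun x => (s x).pt)
    (hj : ∀ (c : FibredChart n m π), ∀ x ∈ c.dom (fun x => (s x).pt),
      c.jetRep s x = c.prolongRep (fun x => (s x).pt) x) : SolvesCartan L s := by
  intro c x hx v vhat a u
  have hv : vhat = v := (hj c x hx).symm
  have ha : a = fun l => fderiv ℝ (c.prolongRep fun x => (s x).pt) x (bvec l) := by
    have h : c.jetRep s =ᶠ[nhds x] c.prolongRep fun x => (s x).pt :=
      Filter.eventually_of_mem ((isOpen_dom hs).mem_nhds hx) (hj c)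
    funext l
    exact congrArg (fun D : Euc n →L[ℝ] Arr n m => D (bvec l)) h.fderiv_eq
  refine ⟨fun l i => by simp [hv], fun i => ?_⟩
  have h := hsL c x hx i
  simp only [hv, sub_self, zero_mul, Finset.sum_const_zero, add_zero]
  rw [ha]
  simp only [u, v, hj c x hx]
  exact h

section FibreBundle

variable [IsManifold 𝓘(ℝ, Euc n) ∞ X] [IsManifold 𝓘(ℝ, Euc n × Euc m) ∞ Y]
  {M : Type*} [TopologicalSpace M] [ChartedSpace (Euc m) M] [IsManifold 𝓘(ℝ, Euc m) ∞ M]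
  {hπ : IsSmoothFibreBundle n m M π} {H : HamiltonianForm n m π} {L : Lagrangian n m π}
  {r : X → LegendreBundle n m π}

/-- For a solution `r` of the Hamilton equations, `Ĥ ∘ r` is the first jet prolongation of the
projection of `r` to `Y`. -/
theorem SolvesHamilton.jetRep_hamMap (hrH : SolvesHamilton H r)
    (hs : ∀ x, π (r x).pt = x) {c : FibredChart n m π} {x : Euc n}
    (hx : x ∈ c.dom fun x => (r x).pt) :
    c.jetRep (fun x => ⟨(r x).pt, H.hamMap hπ (r x).pt (r x).mom⟩) x =
      c.prolongRep (fun x => (r x).pt) x := by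
  have h := H.jetCoord_hamMap hπ c hx.2 (r (c.base.symm x)).mom
  have e := total_eq (s := fun x => (r x).pt) hs hx
  rw [hrH.prolongRep_eq hx, ← e]
  exact h

/-- A solution `r` of the Hamilton equations with values in the constraint space is the image under
`L̂` of the first jet prolongation of its projection to `Y`. -/
theorem SolvesHamilton.fibreGrad_prolongRep (hHL : WeaklyAssociated hπ H L)
    (hrH : SolvesHamilton H r) (hrN : ∀ x, r x ∈ L.constraintSpace)
    (hs : ∀ x, π (r x).pt = x) {c : FibredChart n m π} {x : Euc n}
    (hx : x ∈ c.dom fun x => (r x).pt) :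
    fibreGrad (c.lagr L.toFun)
      ((x, c.rep (fun x => (r x).pt) x), c.prolongRep (fun x => (r x).pt) x) = c.momRep r x := by
  have h := hHL.fibreGrad_fibreGrad c hx.2 (hrN (c.base.symm x))
  have e := total_eq (s := fun x => (r x).pt) hs hx
  rw [hrH.prolongRep_eq hx, ← e]
  exact h

/-- The second Hamilton equation, with `∂ℋ/∂y^i` replaced by `- ∂ℒ/∂y^i ∘ Ĥ`. -/
theorem SolvesHamilton.fderiv_lagr_eq (hHL : WeaklyAssociated hπ H L)
    (hrH : SolvesHamilton H r) (hrN : ∀ x, r x ∈ L.constraintSpace)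
    (hs : ∀ x, π (r x).pt = x) {c : FibredChart n m π} {x : Euc n}
    (hx : x ∈ c.dom fun x => (r x).pt) (i : Fin m) :
    fderiv ℝ (c.lagr L.toFun)
      ((x, c.rep (fun x => (r x).pt) x), c.prolongRep (fun x => (r x).pt) x) ((0, bvec i), 0) =
      ∑ l, fderiv ℝ (c.momRep r) x (bvec l) l i := by
  have h := hHL.fderiv_ham_eq c hx.2 (hrN (c.base.symm x)) (0, bvec i)
  have e := total_eq (s := fun x => (r x).pt) hs hx
  rw [(hrH c x hx).2 i, hrH.prolongRep_eq hx, ← e]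
  rw [eq_neg_iff_add_eq_zero, add_comm, ← eq_neg_iff_add_eq_zero]
  exact h

theorem SolvesHamilton.solvesEulerLagrange (hHL : WeaklyAssociated hπ H L)
    (hr : IsLegendreSection r) (hrH : SolvesHamilton H r) (hrN : ∀ x, r x ∈ L.constraintSpace) :
    SolvesEulerLagrange L (fun x => (r x).pt) := by
  intro c x hx v a u i
  have hs := hr.isSection
  have hdom : IsOpen (c.dom fun x => (r x).pt) := isOpen_dom hs.smooth.continuous
  have hu : u.1 ∈ c.total.target := by
    change (x, c.rep (fun x => (r x).pt) x) ∈ _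
    rw [← total_eq (s := fun x => (r x).pt) hs.proj_eq hx]
    exact c.total.map_source hx.2
  have hmom : DifferentiableAt ℝ (c.momRep r) x :=
    ((hr.smooth c).contDiffAt (hdom.mem_nhds hx)).differentiableAt (by simp)
  rw [sub_eq_zero]
  refine (hrH.fderiv_lagr_eq hHL hrN hs.proj_eq hx i).trans (Finset.sum_congr rfl fun l _ => ?_)
  let P : Arr n m →L[ℝ] ℝ :=
    (EuclideanSpace.proj i : Euc m →L[ℝ] ℝ).comp (ContinuousLinearMap.proj l)
  have hdiff : DifferentiableAt ℝ (L.mom c l i) u :=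
    P.differentiableAt.comp u (L.differentiableAt_fibreGrad c hu)
  refine Eq.symm ((totalDeriv_prolongRep hs.smooth hx hdiff l).trans ?_)
  have heq : (fun x' => L.mom c l i ((x', c.rep (fun x => (r x).pt) x'),
      c.prolongRep (fun x => (r x).pt) x')) =ᶠ[nhds x] fun x' => P (c.momRep r x') := by
    filter_upwards [hdom.mem_nhds hx] with x' hx'
    exact congrArg P (hrH.fibreGrad_prolongRep hHL hrN hs.proj_eq hx')
  have hP : HasFDerivAt (fun x' => P (c.momRep r x')) (P.comp (fderiv ℝ (c.momRep r) x)) x :=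
    P.hasFDerivAt.comp x hmom.hasFDerivAt
  rw [heq.fderiv_eq, hP.fderiv]
  rfl

end FibreBundle

end Polysymplectic

theorem theorem4 {n m : ℕ} {X Y M : Type*}
    [TopologicalSpace X] [ChartedSpace (Euc n) X] [IsManifold 𝓘(ℝ, Euc n) ∞ X]
    [T2Space X] [SecondCountableTopology X] [ConnectedSpace X]
    [TopologicalSpace Y] [ChartedSpace (Euc n × Euc m) Y]
    [IsManifold 𝓘(ℝ, Euc n × Euc m) ∞ Y]
    [T2Space Y] [SecondCountableTopology Y] [ConnectedSpace Y]
    [TopologicalSpace M] [ChartedSpace (Euc m) M] [IsManifold 𝓘(ℝ, Euc m) ∞ M]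
    [T2Space M] [SecondCountableTopology M]
    {π : Y → X} (hπ : IsSmoothFibreBundle n m M π)
    (L : Lagrangian n m π) (hL : L.AlmostRegular)
    (H : HamiltonianForm n m π) (hHL : WeaklyAssociated hπ H L)
    (r : X → LegendreBundle n m π) (hr : IsLegendreSection r)
    (hrH : SolvesHamilton H r) (hrN : ∀ x, r x ∈ L.constraintSpace) :
    (IsSection n m π (fun x => (r x).pt) ∧
      SolvesEulerLagrange L (fun x => (r x).pt)) ∧
    (IsJetSection (fun x => (⟨(r x).pt, H.hamMap hπ (r x).pt (r x).mom⟩ : JetBundle n m π)) ∧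
      SolvesCartan L (fun x => ⟨(r x).pt, H.hamMap hπ (r x).pt (r x).mom⟩)) := by 
  have hs := hr.isSection
  have hEL := hrH.solvesEulerLagrange hHL hr hrN
  have hj : ∀ (c : FibredChart n m π), ∀ x ∈ c.dom (fun x => (r x).pt),
      c.jetRep (fun x => ⟨(r x).pt, H.hamMap hπ (r x).pt (r x).mom⟩) x =
        c.prolongRep (fun x => (r x).pt) x :=
    fun c x hx => hrH.jetRep_hamMap hs.proj_eq hx
  refine ⟨⟨hs, hEL⟩, ⟨hs, fun c => ?_⟩, hEL.solvesCartan hs.smooth.continuous hj⟩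
  exact (FibredChart.contDiffOn_prolongRep hs.smooth).congr (hj c)
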